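/- Let $\operatorname{Log}$ be the principal logarithm on the cut plane $\mathcal A=\mathbb C\setminus(-\infty,0]$ and put $$G(z)=\left(1-\frac{\operatorname{Log} z}{\operatorname{Log}(1+z)}\right)z\operatorname{Log} z,\qquad z\in\mathcal A,$$ so that $G(x)=\left(1-\frac{\ln x}{\ln(1+x)}\right)x\ln x$ for $x>0$. Let $$\rho(t)=\begin{cases}-\dfrac{t\ln\left((1-t)/t^2\right)}{\ln(1-t)}, & 0<t<1,\\[2ex] -\dfrac{t\left(\ln((t-1)/t)\right)^2}{(\ln(t-1))^2+\pi^2}, & 1<t<\infty,\end{cases}$$ and $\rho(1)=-1$. Then: 1. For every $s\ge 0$ the integral $\varphi(s)=\int_0^\infty e^{-st}\rho(t)\,dt$ converges absolutely, and $\varphi(s)>0$. 2. For every $z\in\mathbb C$ with $\operatorname{Re} z>0$, $$1-G(z)=\int_0^\infty e^{-zs}\varphi(s)\,ds,$$ with an absolutely convergent integral. 3. The functions $1-G$ and $G'$ are completely monotonic on $(0,\infty)$, where $f:(0,\infty)\to\mathbb R$ is called completely monotonic if it is infinitely differentiable and $(-1)^nf^{(n)}(x)\ge 0$ for all $n\ge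 0$ and $x>0$. 4. (Conjecture of Qi and Guo) $(-1)^{k-1}G^{(k)}(x)>0$ for all $x>0$ and $k=1,2,\ldots$ -/

import Mathlib

open Set MeasureTheory
open scoped ContDiff

noncomputable section

namespace AlzerQiGuo

/-- The function `G(x) = (1 - ln x / ln (1 + x)) x ln x`, studied for `x > 0`. -/
def realG (x : ℝ) : ℝ :=
  (1 - Real.log x / Real.log (1 + x)) * (x * Real.log x)

/-- The holomorphic extension `G(z) = (1 - Log z / Log (1 + z)) z Log z` to the cut plane
`ℂ \ (-∞, 0]`, where `Log` is the principal logarithm. -/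
def complexG (z : ℂ) : ℂ :=
  (1 - Complex.log z / Complex.log (1 + z)) * (z * Complex.log z)

/-- The function `ρ` on the positive half-line. The value `-1` at `t = 1` is the common
one-sided limit there; values at `t ≤ 0` are never used. -/
def rho (t : ℝ) : ℝ :=
  if t < 1 then
    -(t * Real.log ((1 - t) / t ^ 2) / Real.log (1 - t))
  else if 1 < t then
    -(t * Real.log ((t - 1) / t) ^ 2 / (Real.log (t - 1) ^ 2 + Real.pi ^ 2))
  else -1

/-- The Laplace transform `φ(s) = ∫_0^∞ e^{-st} ρ(t) dt` of `ρ`, for `s ≥ 0`. -/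
def phi (s : ℝ) : ℝ :=
  ∫ t in Ioi (0 : ℝ), Real.exp (-(s * t)) * rho t

/-- `f` is completely monotonic on `(0, ∞)`: it is infinitely differentiable there and
`(-1)^n f^{(n)}(x) ≥ 0` for all `n ≥ 0` and `x > 0`. -/
def IsCompletelyMonotonic (f : ℝ → ℝ) : Prop :=
  ContDiffOn ℝ ∞ f (Ioi 0) ∧
    ∀ n : ℕ, ∀ x : ℝ, 0 < x → 0 ≤ (-1 : ℝ) ^ n * iteratedDeriv n f x

end AlzerQiGuo

end

namespace AlzerQiGuo

open Complex Filter Topology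
open scoped ComplexConjugate

/-! The function 1 - G is a Stieltjes transform: 1 - G(z) = ∫ ρ(t)/(t + z) dt over t > 0 for Re z >
0, where -πρ(t) is the imaginary part of its boundary value at -t from above
(`one_sub_complexG_eq_integral`). This is Cauchy's formula on the cut plane. It is carried out in
the coordinate w = log z, where the cut plane becomes the strip |Im w| < π, the two sides of the cut
become its edges, and 1 - G extends continuously to the closed strip, even over z = -1. A keyhole
contour becomes a rectangle. Its horizontal sides give the integral of ρ, its right side gives -(1 -
G(z)), and its left side vanishes in the limit.

The density ρ is not positive, but it changes sign only once, from plus to minus, at the root a of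
a² = 1 - a. Hence e^{-st}ρ(t) ≥ e^{-sa}ρ(t) for all t > 0, and φ(s) ≥ e^{-sa}∫ρ (`phi_pos`). The
integral of ρ is positive because it is the limit of x(1 - G(x)) as x → ∞, and this quantity is at
least 1/4 for x ≥ 1.

Fubini turns the Stieltjes transform into the Laplace transform of φ > 0. Differentiating under the
integral gives every sign, strictly. -/

/-! ### The function 1 - G on the closed logarithmic strip. -/

/-- The closed strip `|Im w| ≤ π`, the image of the cut plane with its two-sided boundary
under the logarithm. -/
def strip : Set ℂ := {w | |w.im| ≤ Real.pi}

/-- The continuation of `w ↦ log (1 + e ^ w)` to the closed strip. -/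
noncomputable def logOneAddExp (w : ℂ) : ℂ := w / 2 + log (2 * cosh (w / 2))

/-- The reciprocal of `logOneAddExp`, continued by zero to the zeros of `1 + e ^ w`. -/
noncomputable def invLogOneAddExp (w : ℂ) : ℂ :=
  if cosh (w / 2) = 0 then 0 else (logOneAddExp w)⁻¹

/-- The function `1 - G` in the logarithmic coordinate, on the closed strip. -/
noncomputable def stripFun (w : ℂ) : ℂ := 1 - exp w * w * (1 - w * invLogOneAddExp w)

lemma cosh_half_re (w : ℂ) :
    (cosh (w / 2)).re = Real.cosh (w.re / 2) * Real.cos (w.im / 2) := by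
  have h : w / 2 = ((w.re / 2 : ℝ) : ℂ) + ((w.im / 2 : ℝ) : ℂ) * I := by
    apply Complex.ext <;> simp
  rw [h, cosh_add, cosh_mul_I, sinh_mul_I, ← ofReal_cosh, ← ofReal_sinh, ← ofReal_cos,
    ← ofReal_sin]
  simp only [add_re, mul_re, mul_im, ofReal_re, ofReal_im, I_re, I_im]
  ring

lemma cosh_half_re_nonneg {w : ℂ} (hw : w ∈ strip) : 0 ≤ (cosh (w / 2)).re := by
  rw [cosh_half_re]
  have := abs_le.1 (show |w.im| ≤ Real.pi from hw)
  exact mul_nonneg (Real.cosh_pos _).le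
    (Real.cos_nonneg_of_mem_Icc ⟨by linarith, by linarith⟩)

lemma cosh_half_ne_zero_of_abs_im_lt {w : ℂ} (hw : |w.im| < Real.pi) : cosh (w / 2) ≠ 0 := by
  have := abs_lt.1 hw
  have h : 0 < (cosh (w / 2)).re := by
    rw [cosh_half_re]
    exact mul_pos (Real.cosh_pos _) (Real.cos_pos_of_mem_Ioo ⟨by linarith, by linarith⟩)
  intro h0
  simp [h0] at h

lemma one_add_exp_eq (w : ℂ) : 1 + exp w = exp (w / 2) * (2 * cosh (w / 2)) := by
  rw [Complex.two_cosh, mul_add, ← exp_add, ← exp_add]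
  simp [add_comm]

lemma exp_logOneAddExp {w : ℂ} (h : cosh (w / 2) ≠ 0) : exp (logOneAddExp w) = 1 + exp w := by
  rw [logOneAddExp, exp_add, exp_log (by simpa using h), one_add_exp_eq]

lemma logOneAddExp_ne_zero {w : ℂ} (h : cosh (w / 2) ≠ 0) : logOneAddExp w ≠ 0 := by
  intro h0
  have := exp_logOneAddExp h
  rw [h0, exp_zero] at this
  exact exp_ne_zero w (by linear_combination -this)

/-- The closed right half-plane meets the branch cut only at 0. This is the point of factoring out
`exp (w / 2)`: on the edges with Re w > 0, `1 + exp w` itself lies on the cut. -/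
lemma two_cosh_half_mem_slitPlane {w : ℂ} (hw : w ∈ strip) (h : cosh (w / 2) ≠ 0) :
    2 * cosh (w / 2) ∈ slitPlane := by
  have h0 := cosh_half_re_nonneg hw
  rw [mem_slitPlane_iff]
  rcases h0.lt_or_eq with h1 | h1
  · left; simpa using h1
  · right
    intro h2
    exact h (Complex.ext h1.symm (by simpa using h2))

lemma logOneAddExp_im_mem {w : ℂ} (hw : w ∈ strip) :
    (logOneAddExp w).im ∈ Icc (-Real.pi) Real.pi := by
  have h1 : |arg (2 * cosh (w / 2))| ≤ Real.pi / 2 := by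
    rw [abs_arg_le_pi_div_two_iff]
    simpa using cosh_half_re_nonneg hw
  have h2 := abs_le.1 (show |w.im| ≤ Real.pi from hw)
  have h3 := abs_le.1 h1
  have h4 : (logOneAddExp w).im = w.im / 2 + arg (2 * cosh (w / 2)) := by
    simp [logOneAddExp, log_im]
  rw [h4]
  constructor <;> linarith [h2.1, h2.2, h3.1, h3.2]

lemma logOneAddExp_eq {w : ℂ} (hw : w ∈ strip) (h : 0 < (1 + exp w).re) :
    logOneAddExp w = log (1 + exp w) := by
  have hc : cosh (w / 2) ≠ 0 := by
    intro h0
    rw [one_add_exp_eq, h0] at h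
    simp at h
  have he := exp_logOneAddExp hc
  have hm := logOneAddExp_im_mem hw
  rw [← he, log_exp _ hm.2]
  -- Imaginary part -π would make `1 + exp w` negative real.
  refine lt_of_le_of_ne hm.1 fun h1 => ?_
  rw [← he, exp_re, ← h1, Real.cos_neg, Real.cos_pi] at h
  linarith [Real.exp_pos (logOneAddExp w).re]

lemma logOneAddExp_sub (w : ℂ) : logOneAddExp w - w = logOneAddExp (-w) := by
  simp only [logOneAddExp, neg_div, cosh_neg]
  ring

lemma cosh_half_conj (w : ℂ) : cosh (conj w / 2) = conj (cosh (w / 2)) := by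
  rw [← cosh_conj, map_div₀, map_ofNat (starRingEnd ℂ) 2]

lemma logOneAddExp_conj {w : ℂ} (hw : w ∈ strip) (h : cosh (w / 2) ≠ 0) :
    logOneAddExp (conj w) = conj (logOneAddExp w) := by
  have h1 := (mem_slitPlane_iff_arg.1 (two_cosh_half_mem_slitPlane hw h)).1
  simp only [logOneAddExp, cosh_half_conj, map_add, ← log_conj _ h1, map_div₀, map_mul,
    map_ofNat (starRingEnd ℂ) 2]

lemma invLogOneAddExp_conj {w : ℂ} (hw : w ∈ strip) :
    invLogOneAddExp (conj w) = conj (invLogOneAddExp w) := by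
  unfold invLogOneAddExp
  rw [cosh_half_conj]
  by_cases h : cosh (w / 2) = 0
  · simp [h]
  · simp [h, logOneAddExp_conj hw h]

lemma stripFun_conj {w : ℂ} (hw : w ∈ strip) : stripFun (conj w) = conj (stripFun w) := by
  simp [stripFun, invLogOneAddExp_conj hw, exp_conj]

lemma differentiableAt_invLogOneAddExp {w : ℂ} (hw : w ∈ strip) (h : cosh (w / 2) ≠ 0) :
    DifferentiableAt ℂ invLogOneAddExp w := by
  have h1 : DifferentiableAt ℂ (fun v => (logOneAddExp v)⁻¹) w := by
    refine DifferentiableAt.inv ?_ (logOneAddExp_ne_zero h)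
    unfold logOneAddExp
    refine DifferentiableAt.add (by fun_prop) (DifferentiableAt.clog (by fun_prop) ?_)
    exact two_cosh_half_mem_slitPlane hw h
  refine h1.congr_of_eventuallyEq ?_
  have h2 : ∀ᶠ v in 𝓝 w, cosh (v / 2) ≠ 0 :=
    ContinuousAt.eventually_ne (by fun_prop) h
  filter_upwards [h2] with v hv
  simp [invLogOneAddExp, hv]

lemma tendsto_log_cobounded : Tendsto log (𝓝[≠] 0) (Bornology.cobounded ℂ) := by
  rw [← tendsto_norm_atTop_iff_cobounded]
  have h1 : Tendsto (fun z : ℂ => -Real.log ‖z‖) (𝓝[≠] 0) atTop :=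
    tendsto_neg_atBot_atTop.comp (Real.tendsto_log_nhdsGT_zero.comp tendsto_norm_nhdsNE_zero)
  refine tendsto_atTop_mono (fun z => ?_) h1
  have := abs_re_le_norm (log z)
  rw [log_re] at this
  exact (neg_le_abs _).trans this

/-- The argument of the logarithm tends to 0, so the logarithm tends to infinity in modulus while
w/2 stays bounded; the reciprocal tends to the assigned value 0. -/
lemma continuousAt_invLogOneAddExp_of_eq_zero {w : ℂ} (h : cosh (w / 2) = 0) :
    ContinuousAt invLogOneAddExp w := by
  have h0 : invLogOneAddExp w = 0 := by simp [invLogOneAddExp, h]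
  rw [ContinuousAt, h0]
  refine Filter.Tendsto.if tendsto_const_nhds ?_
  refine tendsto_inv₀_cobounded.comp ?_
  have hc : Tendsto (fun v : ℂ => 2 * cosh (v / 2)) (𝓝 w ⊓ 𝓟 {v | ¬cosh (v / 2) = 0})
      (𝓝[≠] 0) := by
    refine tendsto_nhdsWithin_iff.2 ⟨?_, ?_⟩
    · have : ContinuousAt (fun v : ℂ => 2 * cosh (v / 2)) w := by fun_prop
      rw [ContinuousAt, h, mul_zero] at this
      exact this.mono_left inf_le_left
    · filter_upwards [mem_inf_of_right (mem_principal_self _)] with v hv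
      simpa using hv
  have h2 : Tendsto (fun v : ℂ => ‖v / 2‖) (𝓝 w ⊓ 𝓟 {v | ¬cosh (v / 2) = 0})
      (𝓝 ‖w / 2‖) := by
    have : ContinuousAt (fun v : ℂ => ‖v / 2‖) w := by fun_prop
    exact this.tendsto.mono_left inf_le_left
  rw [← tendsto_norm_atTop_iff_cobounded]
  refine tendsto_atTop_mono (fun v => ?_) (Tendsto.add_atTop h2.neg
    (tendsto_norm_cobounded_atTop.comp (tendsto_log_cobounded.comp hc)))
  have := norm_sub_le (logOneAddExp v) (v / 2)
  simp only [logOneAddExp, add_sub_cancel_left] at this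
  simp only [Function.comp]
  unfold logOneAddExp
  linarith

lemma continuousOn_invLogOneAddExp : ContinuousOn invLogOneAddExp strip := by
  intro w hw
  by_cases h : cosh (w / 2) = 0
  · exact (continuousAt_invLogOneAddExp_of_eq_zero h).continuousWithinAt
  · exact (differentiableAt_invLogOneAddExp hw h).continuousAt.continuousWithinAt

lemma continuousOn_stripFun : ContinuousOn stripFun strip := by
  have := continuousOn_invLogOneAddExp
  unfold stripFun
  fun_prop

lemma differentiableAt_stripFun {w : ℂ} (hw : |w.im| < Real.pi) :
    DifferentiableAt ℂ stripFun w := by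
  have := differentiableAt_invLogOneAddExp (show w ∈ strip from hw.le)
    (cosh_half_ne_zero_of_abs_im_lt hw)
  unfold stripFun
  fun_prop

lemma stripFun_log {z : ℂ} (hz : 0 < z.re) : stripFun (log z) = 1 - complexG z := by
  have hz0 : z ≠ 0 := by rintro rfl; simp at hz
  have him : |(log z).im| < Real.pi := by
    rw [log_im]
    exact (abs_arg_lt_pi_div_two_iff.2 (Or.inl hz)).trans (by linarith [Real.pi_pos])
  have h1 : logOneAddExp (log z) = log (1 + z) := by
    rw [logOneAddExp_eq him.le, exp_log hz0]
    rw [exp_log hz0, add_re, one_re]; linarith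
  rw [stripFun, invLogOneAddExp, if_neg (cosh_half_ne_zero_of_abs_im_lt him), h1, exp_log hz0,
    complexG]
  ring

/-! ### Limits at the two ends of the strip. -/

/-- Approach to `+∞` inside the strip. -/
def stripTop : Filter ℂ := comap re atTop ⊓ 𝓟 strip

/-- Approach to `-∞` inside the strip. -/
def stripBot : Filter ℂ := comap re atBot ⊓ 𝓟 strip

lemma tendsto_neg_stripTop : Tendsto (fun w : ℂ => -w) stripTop stripBot := by
  refine tendsto_inf.2 ⟨?_, ?_⟩
  · rw [tendsto_comap_iff]
    exact (tendsto_neg_atTop_atBot.comp tendsto_comap).mono_left inf_le_left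
  · refine tendsto_principal.2 ?_
    filter_upwards [mem_inf_of_right (mem_principal_self _)] with w hw
    simpa [strip] using hw

lemma tendsto_re_stripBot : Tendsto re stripBot atBot := tendsto_comap.mono_left inf_le_left

lemma tendsto_re_stripTop : Tendsto re stripTop atTop := tendsto_comap.mono_left inf_le_left

lemma eventually_mem_strip_stripBot : ∀ᶠ w in stripBot, w ∈ strip :=
  mem_inf_of_right (mem_principal_self _)

lemma tendsto_pow_mul_exp_stripBot (n : ℕ) :
    Tendsto (fun w : ℂ => w ^ n * exp w) stripBot (𝓝 0) := by
  rw [tendsto_zero_iff_norm_tendsto_zero]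
  have h1 : Tendsto (fun x : ℝ => (Real.pi + x) ^ n * Real.exp (-x)) atTop (𝓝 0) := by
    have h2 := (Real.tendsto_pow_mul_exp_neg_atTop_nhds_zero n).comp
      (tendsto_atTop_add_const_left atTop Real.pi tendsto_id)
    have h3 := h2.const_mul (Real.exp Real.pi)
    rw [mul_zero] at h3
    refine h3.congr fun x => ?_
    simp only [Function.comp, id]
    rw [mul_left_comm, ← Real.exp_add]
    ring_nf
  refine squeeze_zero' (Eventually.of_forall fun _ => norm_nonneg _) ?_
    (h1.comp (tendsto_neg_atBot_atTop.comp tendsto_re_stripBot))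
  filter_upwards [eventually_mem_strip_stripBot, tendsto_re_stripBot.eventually_le_atBot 0]
    with w hw h0
  simp only [Function.comp, norm_mul, norm_pow, norm_exp, neg_neg]
  gcongr
  have := norm_le_abs_re_add_abs_im w
  rw [abs_of_nonpos h0] at this
  have h4 : |w.im| ≤ Real.pi := hw
  linarith

lemma tendsto_exp_stripBot : Tendsto exp stripBot (𝓝 0) := by
  simpa using tendsto_pow_mul_exp_stripBot 0

lemma eventually_logOneAddExp_eq :
    ∀ᶠ w in stripBot, cosh (w / 2) ≠ 0 ∧ logOneAddExp w = log (1 + exp w) := by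
  have h : Tendsto (fun w : ℂ => (1 + exp w).re) stripBot (𝓝 1) := by
    have : ContinuousAt (fun v : ℂ => (1 + v).re) 0 := by fun_prop
    simpa [Function.comp_def] using this.tendsto.comp tendsto_exp_stripBot
  filter_upwards [eventually_mem_strip_stripBot, h.eventually_const_lt zero_lt_one] with w hw hr
  refine ⟨fun h0 => ?_, logOneAddExp_eq hw hr⟩
  rw [one_add_exp_eq, h0] at hr
  simp at hr

lemma tendsto_logOneAddExp_div_exp :
    Tendsto (fun w : ℂ => logOneAddExp w / exp w) stripBot (𝓝 1) := by
  have h : HasDerivAt log 1 (1 : ℂ) := by simpa using hasDerivAt_log one_mem_slitPlane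
  have h1 := h.tendsto_slope_zero
  simp only [log_one, sub_zero, smul_eq_mul] at h1
  have h2 : Tendsto exp stripBot (𝓝[≠] 0) :=
    tendsto_nhdsWithin_iff.2 ⟨tendsto_exp_stripBot, Eventually.of_forall fun w => exp_ne_zero w⟩
  refine (h1.comp h2).congr' ?_
  filter_upwards [eventually_logOneAddExp_eq] with w hw
  simp only [Function.comp]
  rw [hw.2, div_eq_inv_mul]

lemma tendsto_stripFun_mul_exp_stripBot :
    Tendsto (fun w => stripFun w * exp w) stripBot (𝓝 0) := by
  have h1 : Tendsto (fun w => exp w * invLogOneAddExp w) stripBot (𝓝 1) := by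
    have := tendsto_logOneAddExp_div_exp.inv₀ one_ne_zero
    rw [inv_one] at this
    refine this.congr' ?_
    filter_upwards [eventually_logOneAddExp_eq] with w hw
    rw [invLogOneAddExp, if_neg hw.1, inv_div, div_eq_mul_inv]
  have h2 := (tendsto_exp_stripBot.sub
    ((tendsto_pow_mul_exp_stripBot 1).mul tendsto_exp_stripBot)).add
    ((tendsto_pow_mul_exp_stripBot 2).mul h1)
  simp only [mul_zero, zero_mul, sub_zero, add_zero] at h2
  refine h2.congr fun w => ?_
  rw [stripFun]
  ring

/-- Writing L for `logOneAddExp`, L(w) = w + L(-w) turns the function into 1 - e^w L(-w) / (1 +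
L(-w)/w), and e^w L(-w) → 1 because log(1 + u) ~ u. -/
lemma tendsto_stripFun_stripTop : Tendsto stripFun stripTop (𝓝 0) := by
  have h1 : Tendsto (fun w : ℂ => exp w * logOneAddExp (-w)) stripTop (𝓝 1) := by
    refine (tendsto_logOneAddExp_div_exp.comp tendsto_neg_stripTop).congr fun w => ?_
    simp only [Function.comp]
    rw [exp_neg, div_inv_eq_mul, mul_comm]
  have h2 : Tendsto (fun w : ℂ => w⁻¹) stripTop (𝓝 0) := by
    refine tendsto_inv₀_cobounded.comp ?_
    rw [← tendsto_norm_atTop_iff_cobounded]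
    exact tendsto_atTop_mono (fun w => re_le_norm w) tendsto_re_stripTop
  have h3 : Tendsto (fun w : ℂ => logOneAddExp (-w)) stripTop (𝓝 0) := by
    have := h1.mul (tendsto_exp_stripBot.comp tendsto_neg_stripTop)
    rw [mul_zero] at this
    refine this.congr fun w => ?_
    simp only [Function.comp]
    rw [mul_right_comm, ← exp_add]
    simp
  have h4 : Tendsto (fun w : ℂ => (1 + w⁻¹ * logOneAddExp (-w))⁻¹) stripTop (𝓝 1) := by
    have := (tendsto_const_nhds (x := (1 : ℂ))).add (h2.mul h3)
    simp only [mul_zero, add_zero] at this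
    simpa using this.inv₀ one_ne_zero
  have h5 := (tendsto_const_nhds (x := (1 : ℂ))).sub (h1.mul h4)
  simp only [mul_one, sub_self] at h5
  refine h5.congr' ?_
  have h6 := tendsto_neg_stripTop.eventually eventually_logOneAddExp_eq
  filter_upwards [h6, tendsto_re_stripTop.eventually_gt_atTop 0] with w hw hr
  have hw0 : w ≠ 0 := by rintro rfl; simp at hr
  have hc : cosh (w / 2) ≠ 0 := by simpa [neg_div] using hw.1
  have hl := logOneAddExp_ne_zero hc
  rw [stripFun, invLogOneAddExp, if_neg hc, ← logOneAddExp_sub]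
  have h7 : 1 + w⁻¹ * (logOneAddExp w - w) = logOneAddExp w / w := by field_simp; ring
  rw [h7]
  field_simp

/-! ### Boundary values on the upper edge, and ρ. -/

lemma logOneAddExp_upper_of_neg {x : ℝ} (hx : x < 0) :
    logOneAddExp (x + Real.pi * I) = (Real.log (1 - Real.exp x) : ℝ) := by
  have h1 : 1 + exp (x + Real.pi * I) = ((1 - Real.exp x : ℝ) : ℂ) := by
    rw [exp_add, exp_pi_mul_I]; push_cast; ring
  have h2 : 0 < 1 - Real.exp x := by linarith [Real.exp_lt_one_iff.2 hx]
  rw [logOneAddExp_eq (by simp [strip, abs_of_pos Real.pi_pos]), h1, ofReal_log h2.le]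
  rw [h1, ofReal_re]; exact h2

lemma cosh_half_upper (x : ℝ) :
    cosh (((x : ℂ) + Real.pi * I) / 2) = (Real.sinh (x / 2) : ℝ) * I := by
  have h : ((x : ℂ) + Real.pi * I) / 2 = ((x / 2 : ℝ) : ℂ) + ((Real.pi / 2 : ℝ) : ℂ) * I := by
    push_cast; ring
  rw [h, cosh_add, cosh_mul_I, sinh_mul_I, ← ofReal_cos, ← ofReal_sin, Real.cos_pi_div_two,
    Real.sin_pi_div_two]
  simp

lemma cosh_half_upper_ne_zero {x : ℝ} (hx : x ≠ 0) :
    cosh (((x : ℂ) + Real.pi * I) / 2) ≠ 0 := by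
  rw [cosh_half_upper]
  refine mul_ne_zero ?_ I_ne_zero
  rw [Ne, ofReal_eq_zero, Real.sinh_eq_zero]
  simpa using hx

/-- Here `cosh (w / 2)` is `I` times a positive number; its logarithm contributes πi/2 and the
summand w/2 contributes the other πi/2. -/
lemma logOneAddExp_upper_of_pos {x : ℝ} (hx : 0 < x) :
    logOneAddExp (x + Real.pi * I) = (Real.log (Real.exp x - 1) : ℝ) + Real.pi * I := by
  have hs : 0 < Real.sinh (x / 2) := Real.sinh_pos_iff.2 (by linarith)
  have h1 : Real.log (Real.exp x - 1) = x / 2 + Real.log (2 * Real.sinh (x / 2)) := by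
    have : Real.exp x - 1 = Real.exp (x / 2) * (2 * Real.sinh (x / 2)) := by
      rw [Real.sinh_eq, Real.exp_neg, show x = x / 2 + x / 2 by ring, Real.exp_add]
      field_simp
      ring_nf
    rw [this, Real.log_mul (Real.exp_pos _).ne' (by positivity), Real.log_exp]
  rw [logOneAddExp, cosh_half_upper, h1, ← mul_assoc,
    show (2 : ℂ) * (Real.sinh (x / 2) : ℝ) = ((2 * Real.sinh (x / 2) : ℝ) : ℂ) by push_cast; rfl,
    log_ofReal_mul (by positivity) I_ne_zero, log_I]
  push_cast
  ring

lemma rho_eq_of_lt_one {t : ℝ} (h0 : 0 < t) (h1 : t < 1) :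
    rho t = -t + 2 * t * Real.log t / Real.log (1 - t) := by
  have h : Real.log (1 - t) < 0 := Real.log_neg (by linarith) (by linarith)
  rw [rho, if_pos h1, Real.log_div (by linarith) (by positivity), Real.log_pow]
  field_simp [h.ne]
  push_cast
  ring

lemma rho_eq_of_one_lt {t : ℝ} (h1 : 1 < t) :
    rho t = -(t * (Real.log (t - 1) - Real.log t) ^ 2 /
      (Real.log (t - 1) ^ 2 + Real.pi ^ 2)) := by
  rw [rho, if_neg h1.not_gt, if_pos h1, Real.log_div (by linarith) (by linarith)]

lemma stripFun_upper_im {x : ℝ} (hx : x ≠ 0) :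
    (stripFun (x + Real.pi * I)).im = -(Real.pi * rho (Real.exp x)) := by
  have he : exp (x + Real.pi * I) = ((-Real.exp x : ℝ) : ℂ) := by
    rw [exp_add, exp_pi_mul_I]; push_cast; ring
  rw [stripFun, invLogOneAddExp, if_neg (cosh_half_upper_ne_zero hx), he]
  rcases hx.lt_or_gt with h | h
  · have h1 := Real.exp_lt_one_iff.2 h
    rw [logOneAddExp_upper_of_neg h, rho_eq_of_lt_one (Real.exp_pos x) h1, Real.log_exp,
      ← ofReal_inv]
    simp only [sub_im, sub_re, add_re, add_im, mul_re, mul_im, ofReal_re, ofReal_im, I_re, I_im,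
      one_re, one_im]
    ring
  · have h1 := Real.one_lt_exp_iff.2 h
    rw [logOneAddExp_upper_of_pos h, rho_eq_of_one_lt h1, Real.log_exp]
    have hp := Real.pi_pos
    simp only [sub_im, sub_re, add_re, add_im, mul_re, mul_im, ofReal_re, ofReal_im, I_re, I_im,
      one_re, one_im, inv_re, inv_im, normSq_apply]
    set a := Real.log (Real.exp x - 1)
    have : a ^ 2 + Real.pi ^ 2 ≠ 0 := by positivity
    have : a * a + Real.pi * Real.pi ≠ 0 := by rwa [← sq, ← sq]
    field_simp
    ring

/-! ### Integrability of ρ. -/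

lemma measurable_rho : Measurable rho := by
  unfold rho
  refine Measurable.ite measurableSet_Iio ?_ (Measurable.ite measurableSet_Ioi ?_ ?_)
  · have := Real.measurable_log
    fun_prop
  · have := Real.measurable_log
    fun_prop
  · fun_prop

lemma abs_rho_le_of_le_one {t : ℝ} (h0 : 0 < t) (h1 : t ≤ 1) :
    |rho t| ≤ 1 + 2 * |Real.log t| := by
  rcases h1.lt_or_eq with h | rfl
  · have h2 : Real.log (1 - t) ≤ -t := by
      linarith [Real.log_le_sub_one_of_pos (show 0 < 1 - t by linarith)]
    have h3 : t / |Real.log (1 - t)| ≤ 1 := by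
      rw [abs_of_neg (by linarith), div_le_one (by linarith)]; linarith
    rw [rho_eq_of_lt_one h0 h]
    refine (abs_add_le _ _).trans (add_le_add (by rw [abs_neg, abs_of_pos h0]; exact h1) ?_)
    rw [abs_div, abs_mul, abs_mul, abs_of_pos h0, abs_two]
    calc 2 * t * |Real.log t| / |Real.log (1 - t)|
        = 2 * |Real.log t| * (t / |Real.log (1 - t)|) := by ring
      _ ≤ 2 * |Real.log t| * 1 := by gcongr
      _ = _ := mul_one _
  · simp [rho]

lemma abs_rho_le_of_le_two {t : ℝ} (h1 : 1 < t) (h2 : t ≤ 2) : |rho t| ≤ 4 := by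
  have hb : 0 ≤ Real.log t := Real.log_nonneg h1.le
  have hb' : Real.log t ≤ 1 := by linarith [Real.log_le_sub_one_of_pos (show 0 < t by linarith)]
  have hp := Real.pi_gt_three
  rw [rho_eq_of_one_lt h1, abs_neg, abs_of_nonneg (by positivity), div_le_iff₀ (by positivity)]
  set a := Real.log (t - 1)
  -- (a - b)² ≤ 2a² + 2b² with b = log t ≤ 1 < π; the factor t ≤ 2 then gives 4.
  have h3 : (a - Real.log t) ^ 2 ≤ 2 * (a ^ 2 + Real.pi ^ 2) := by
    nlinarith [sq_nonneg (a + Real.log t)]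
  nlinarith [sq_nonneg (a - Real.log t)]

lemma abs_rho_le_of_two_lt {t : ℝ} (h2 : 2 < t) :
    |rho t| ≤ 2 / ((t - 1) * (Real.log (t - 1) ^ 2 + Real.pi ^ 2)) := by
  have hp := Real.pi_pos
  have ht : 0 < t - 1 := by linarith
  rw [rho_eq_of_one_lt (by linarith), abs_neg, abs_of_nonneg (by positivity), ← div_div]
  gcongr
  have h3 : Real.log t - Real.log (t - 1) ≤ 1 / (t - 1) := by
    rw [← Real.log_div (by linarith) (by linarith)]
    refine (Real.log_le_sub_one_of_pos (by positivity)).trans (le_of_eq ?_)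
    field_simp
    ring
  have h4 : Real.log (t - 1) ≤ Real.log t := Real.log_le_log ht (by linarith)
  calc t * (Real.log (t - 1) - Real.log t) ^ 2
      = t * (Real.log t - Real.log (t - 1)) ^ 2 := by ring
    _ ≤ t * (1 / (t - 1)) ^ 2 := by
        gcongr
    _ ≤ 2 / (t - 1) := by
        rw [div_pow, one_pow, mul_one_div, div_le_div_iff₀ (by positivity) ht]
        nlinarith

/-- The integrand has the bounded antiderivative (2/π) arctan(log(t - 1)/π). The decay is only of
order 1/(t log² t), so the logarithmic factor is essential. -/
lemma integrableOn_rho_tail :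
    IntegrableOn (fun t : ℝ => 2 / ((t - 1) * (Real.log (t - 1) ^ 2 + Real.pi ^ 2)))
      (Ioi 2) := by
  have hp := Real.pi_pos
  have hd : ∀ t : ℝ, 1 < t → HasDerivAt
      (fun t : ℝ => 2 / Real.pi * Real.arctan (Real.log (t - 1) / Real.pi))
      (2 / ((t - 1) * (Real.log (t - 1) ^ 2 + Real.pi ^ 2))) t := by
    intro t ht
    have ht' : 0 < t - 1 := by linarith
    have h := (((((hasDerivAt_id t).sub_const 1).log ht'.ne').div_const Real.pi).arctan).const_mul
      (2 / Real.pi)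
    refine h.congr_deriv ?_
    simp only [id]
    have : Real.pi ^ 2 + Real.log (t - 1) ^ 2 ≠ 0 := by positivity
    have : 1 + (Real.log (t - 1) / Real.pi) ^ 2 ≠ 0 := by positivity
    field_simp
    ring
  have hl : Tendsto (fun t : ℝ => Real.log (t - 1) / Real.pi) atTop atTop :=
    (Real.tendsto_log_atTop.comp
      (tendsto_atTop_add_const_right atTop (-1) tendsto_id)).atTop_div_const hp
  refine integrableOn_Ioi_deriv_of_nonneg
    (hd 2 one_lt_two).continuousAt.continuousWithinAt (fun t ht => hd t (by
      rw [mem_Ioi] at ht; linarith)) (fun t ht => ?_)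
    ((tendsto_nhds_of_tendsto_nhdsWithin (Real.tendsto_arctan_atTop.comp hl)).const_mul _)
  have : 0 < t - 1 := by rw [mem_Ioi] at ht; linarith
  positivity

lemma integrableOn_rho : IntegrableOn rho (Ioi 0) := by
  rw [← Ioc_union_Ioi_eq_Ioi zero_le_one, ← Ioc_union_Ioi_eq_Ioi (one_le_two (α := ℝ))]
  refine IntegrableOn.union ?_ (IntegrableOn.union ?_ ?_)
  · have hl : IntegrableOn (fun t => 1 + 2 * |Real.log t|) (Ioc 0 1) := by
      have := (intervalIntegral.intervalIntegrable_log' (a := 0) (b := 1)).1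
      exact (integrableOn_const (by simp)).add (this.abs.const_mul 2)
    refine hl.mono' measurable_rho.aestronglyMeasurable ?_
    exact (ae_restrict_iff' measurableSet_Ioc).2 (Eventually.of_forall fun t ht =>
      abs_rho_le_of_le_one ht.1 ht.2)
  · refine Measure.integrableOn_of_bounded (M := 4) (by simp)
      measurable_rho.aestronglyMeasurable ?_
    exact (ae_restrict_iff' measurableSet_Ioc).2 (Eventually.of_forall fun t ht =>
      abs_rho_le_of_le_two ht.1 ht.2)
  · refine integrableOn_rho_tail.mono' measurable_rho.aestronglyMeasurable ?_
    exact (ae_restrict_iff' measurableSet_Ioi).2 (Eventually.of_forall fun t ht =>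
      abs_rho_le_of_two_lt ht)

/-! ### Vertical sides of the rectangle, and the substitution t = e^x. -/

lemma tendsto_integral_vertical {P : ℂ → ℂ} (hP : ContinuousOn P strip) {m : Filter ℝ}
    [m.IsCountablyGenerated] {c : ℂ} (h : Tendsto P (comap re m ⊓ 𝓟 strip) (𝓝 c)) :
    Tendsto (fun R : ℝ => ∫ y in (-Real.pi)..Real.pi, P (R + y * I)) m
      (𝓝 (2 * Real.pi * c)) := by
  have hp := Real.pi_pos
  have hmem : ∀ R y : ℝ, y ∈ uIcc (-Real.pi) Real.pi → (R + y * I : ℂ) ∈ strip := by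
    intro R y hy
    rw [uIcc_of_le (by linarith), mem_Icc, ← abs_le] at hy
    simpa [strip] using hy
  have hconst : (2 * Real.pi * c : ℂ) = ∫ _ in (-Real.pi)..Real.pi, c := by
    rw [intervalIntegral.integral_const, real_smul]
    push_cast; ring
  rw [hconst]
  refine intervalIntegral.tendsto_integral_filter_of_dominated_convergence
    (fun _ => ‖c‖ + 1) ?_ ?_ (by simp) ?_
  · refine Eventually.of_forall fun R => ?_
    have : ContinuousOn (fun y : ℝ => P (R + y * I)) (uIcc (-Real.pi) Real.pi) :=
      hP.comp (by fun_prop) (hmem R)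
    exact (this.mono uIoc_subset_uIcc).aestronglyMeasurable measurableSet_uIoc
  -- The limit is uniform in the height y, so one constant dominates for all R far enough along `m`.
  · have h1 : ∀ᶠ w in comap re m ⊓ 𝓟 strip, ‖P w‖ ≤ ‖c‖ + 1 :=
      (h.norm.eventually_lt_const (lt_add_one ‖c‖)).mono fun _ => le_of_lt
    rw [eventually_inf_principal, eventually_comap] at h1
    filter_upwards [h1] with R hR
    refine Eventually.of_forall fun y hy => hR _ (by simp) (hmem R y (uIoc_subset_uIcc hy))
  · refine Eventually.of_forall fun y hy => h.comp ?_
    refine tendsto_inf.2 ⟨?_, tendsto_principal.2 (Eventually.of_forall fun R =>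
      hmem R y (uIoc_subset_uIcc hy))⟩
    rw [tendsto_comap_iff]
    refine tendsto_id.congr fun R => ?_
    simp

lemma integrableOn_rho_div_add {z : ℂ} (hz : 0 < z.re) :
    IntegrableOn (fun t : ℝ => (rho t : ℂ) / (t + z)) (Ioi 0) := by
  have h1 : IntegrableOn (fun t : ℝ => (rho t : ℂ)) (Ioi 0) := integrableOn_rho.ofReal
  have h2 : IntegrableOn (fun t : ℝ => ((t : ℂ) + z)⁻¹ * (rho t : ℂ)) (Ioi 0) := by
    refine h1.bdd_mul (c := z.re⁻¹) ?_ ?_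
    · exact (by fun_prop : Measurable fun t : ℝ => ((t : ℂ) + z)⁻¹).aestronglyMeasurable
    · refine (ae_restrict_iff' measurableSet_Ioi).2 (Eventually.of_forall fun t ht => ?_)
      rw [norm_inv]
      refine inv_anti₀ hz (le_trans ?_ (re_le_norm _))
      have : 0 < t := ht
      simp only [add_re, ofReal_re]
      linarith
  simpa [div_eq_inv_mul] using h2

lemma integrableOn_Ioi_iff_exp {g : ℝ → ℂ} :
    IntegrableOn g (Ioi 0) ↔ Integrable (fun x : ℝ => (Real.exp x : ℂ) * g (Real.exp x)) := by
  have h := integrableOn_image_iff_integrableOn_abs_deriv_smul (s := univ) MeasurableSet.univ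
    (fun x _ => (Real.hasDerivAt_exp x).hasDerivWithinAt) Real.exp_injective.injOn g
  rw [image_univ, Real.range_exp, integrableOn_univ] at h
  rw [h]
  simp only [Real.abs_exp, real_smul]

lemma integral_Ioi_eq_integral_exp (g : ℝ → ℂ) :
    ∫ t in Ioi 0, g t = ∫ x : ℝ, (Real.exp x : ℂ) * g (Real.exp x) := by
  have h := integral_image_eq_integral_abs_deriv_smul (s := univ) MeasurableSet.univ
    (fun x _ => (Real.hasDerivAt_exp x).hasDerivWithinAt) Real.exp_injective.injOn g
  rw [image_univ, Real.range_exp, setIntegral_univ] at h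
  rw [h]
  simp only [Real.abs_exp, real_smul]

/-! ### Cauchy's theorem on the strip and the Stieltjes representation. -/

/-- The Cauchy kernel transported to the strip, applied to `f - f w₀`, with the singularity
at `w₀` removed. -/
noncomputable def stripKernel (f : ℂ → ℂ) (w₀ w : ℂ) : ℂ :=
  dslope f w₀ w * (dslope exp w₀ w)⁻¹ * exp w

/-- Equal exponentials differ by 2πin, and an interior point is less than 2π in height from any
point of the closed strip, so n = 0. -/
lemma exp_ne_exp_of_mem_strip {w₀ w : ℂ} (h₀ : |w₀.im| < Real.pi) (hw : w ∈ strip)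
    (hne : w ≠ w₀) : exp w ≠ exp w₀ := by
  intro h
  obtain ⟨n, hn⟩ := exp_eq_exp_iff_exists_int.1 h
  have h1 : w.im = w₀.im + n * (2 * Real.pi) := by
    rw [hn]; simp
  have h2 := abs_lt.1 h₀
  have h3 := abs_le.1 (show |w.im| ≤ Real.pi from hw)
  have hp := Real.pi_pos
  have h4 : n < 1 := by
    by_contra hc
    have : (1 : ℝ) ≤ n := by exact_mod_cast not_lt.1 hc
    nlinarith
  have h5 : -1 < n := by
    by_contra hc
    have : (n : ℝ) ≤ -1 := by exact_mod_cast not_lt.1 hc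
    nlinarith
  obtain rfl : n = 0 := by omega
  exact hne (by simpa using hn)

lemma dslope_exp_ne_zero {w₀ w : ℂ} (h₀ : |w₀.im| < Real.pi) (hw : w ∈ strip) :
    dslope exp w₀ w ≠ 0 := by
  by_cases h : w = w₀
  · rw [h, dslope_same, Complex.deriv_exp]; exact exp_ne_zero _
  · rw [dslope_of_ne _ h, slope_def_field]
    exact div_ne_zero (sub_ne_zero.2 (exp_ne_exp_of_mem_strip h₀ hw h)) (sub_ne_zero.2 h)

lemma stripKernel_of_ne {w₀ w : ℂ} (f : ℂ → ℂ) (h : w ≠ w₀) :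
    stripKernel f w₀ w = (f w - f w₀) * (exp w / (exp w - exp w₀)) := by
  rw [stripKernel, dslope_of_ne _ h, dslope_of_ne _ h, slope_def_field, slope_def_field]
  have := sub_ne_zero.2 h
  field_simp

lemma isOpen_abs_im_lt : IsOpen {w : ℂ | |w.im| < Real.pi} :=
  isOpen_lt (by fun_prop) continuous_const

lemma abs_im_lt_subset_strip : {w : ℂ | |w.im| < Real.pi} ⊆ strip := fun w hw =>
  le_of_lt (show |w.im| < Real.pi from hw)

lemma continuousOn_stripKernel {f : ℂ → ℂ} {w₀ : ℂ} (h₀ : |w₀.im| < Real.pi)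
    (hf : ContinuousOn f strip) (hd : DifferentiableAt ℂ f w₀) :
    ContinuousOn (stripKernel f w₀) strip := by
  have hn : strip ∈ 𝓝 w₀ := mem_of_superset (isOpen_abs_im_lt.mem_nhds h₀) abs_im_lt_subset_strip
  have h1 : ContinuousOn (dslope f w₀) strip := (continuousOn_dslope hn).2 ⟨hf, hd⟩
  have h2 : ContinuousOn (dslope exp w₀) strip :=
    (continuousOn_dslope hn).2 ⟨by fun_prop, by fun_prop⟩
  exact (h1.mul (h2.inv₀ fun w hw => dslope_exp_ne_zero h₀ hw)).mul (by fun_prop)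

lemma differentiableOn_stripKernel {f : ℂ → ℂ} {w₀ : ℂ} (h₀ : |w₀.im| < Real.pi)
    (hf : DifferentiableOn ℂ f {w | |w.im| < Real.pi}) :
    DifferentiableOn ℂ (stripKernel f w₀) {w | |w.im| < Real.pi} := by
  have hn := isOpen_abs_im_lt.mem_nhds h₀
  have h1 := (differentiableOn_dslope hn).2 hf
  have h2 := (differentiableOn_dslope hn).2
    (differentiable_exp.differentiableOn (s := {w : ℂ | |w.im| < Real.pi}))
  exact (h1.mul (h2.inv fun w hw => dslope_exp_ne_zero h₀ (abs_im_lt_subset_strip hw))).mul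
    (by fun_prop)

lemma stripKernel_rectangle {f : ℂ → ℂ} {w₀ : ℂ} (h₀ : |w₀.im| < Real.pi)
    (hc : ContinuousOn f strip) (hd : DifferentiableOn ℂ f {w | |w.im| < Real.pi}) (R : ℝ) :
    (∫ x in (-R)..R, stripKernel f w₀ (x + (-Real.pi : ℝ) * I)) -
      (∫ x in (-R)..R, stripKernel f w₀ (x + Real.pi * I)) +
      I * (∫ y in (-Real.pi)..Real.pi, stripKernel f w₀ (R + y * I)) -
      I * (∫ y in (-Real.pi)..Real.pi, stripKernel f w₀ ((-R : ℝ) + y * I)) = 0 := by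
  have hp := Real.pi_pos
  refine integral_boundary_rect_eq_zero_of_continuousOn_of_differentiableOn
    (stripKernel f w₀) ⟨-R, -Real.pi⟩ ⟨R, Real.pi⟩ ?_ ?_
  · refine (continuousOn_stripKernel h₀ hc
      (hd.differentiableAt (isOpen_abs_im_lt.mem_nhds h₀))).mono fun w hw => ?_
    have := hw.2
    rw [mem_preimage, uIcc_of_le (by linarith), mem_Icc, ← abs_le] at this
    exact this
  · refine (differentiableOn_stripKernel h₀ hd).mono fun w hw => ?_
    have := hw.2
    rw [mem_preimage, min_eq_left (by linarith), max_eq_right (by linarith)] at this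
    exact abs_lt.2 this

/-- The kernel e^w/(e^w - e^{w₀}) tends to 1 and f to 0, so only the subtracted constant survives.
It plays the part of the residue at w₀. -/
lemma tendsto_stripKernel_stripTop {f : ℂ → ℂ} {w₀ : ℂ} (hf : Tendsto f stripTop (𝓝 0)) :
    Tendsto (stripKernel f w₀) stripTop (𝓝 (-f w₀)) := by
  have h1 : Tendsto (fun w => (1 - exp w₀ * exp (-w))⁻¹) stripTop (𝓝 1) := by
    have := ((tendsto_exp_stripBot.comp tendsto_neg_stripTop).const_mul (exp w₀)).const_sub 1
    rw [mul_zero, sub_zero] at this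
    simpa using this.inv₀ one_ne_zero
  have h2 := (hf.sub_const (f w₀)).mul h1
  rw [zero_sub, mul_one] at h2
  refine h2.congr' ?_
  filter_upwards [tendsto_re_stripTop.eventually_gt_atTop w₀.re] with w hw
  rw [stripKernel_of_ne f (by rintro rfl; exact lt_irrefl _ hw)]
  congr 1
  have h3 := exp_ne_zero w
  rw [exp_neg, inv_eq_one_div, div_eq_div_iff, one_mul]
  · field_simp
  · intro h4
    have h5 : exp w = exp w₀ := by
      field_simp at h4
      linear_combination h4
    have h6 := congrArg norm h5
    rw [norm_exp, norm_exp, Real.exp_eq_exp] at h6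
    exact hw.ne' h6
  · intro h5
    have h6 := congrArg norm (sub_eq_zero.1 h5)
    rw [norm_exp, norm_exp, Real.exp_eq_exp] at h6
    exact hw.ne' h6

lemma tendsto_stripKernel_stripBot {f : ℂ → ℂ} {w₀ : ℂ}
    (hf : Tendsto (fun w => f w * exp w) stripBot (𝓝 0)) :
    Tendsto (stripKernel f w₀) stripBot (𝓝 0) := by
  have h1 : Tendsto (fun w => (exp w - exp w₀)⁻¹) stripBot (𝓝 (0 - exp w₀)⁻¹) :=
    (tendsto_exp_stripBot.sub_const (exp w₀)).inv₀ (by simp)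
  have h2 := (hf.sub (tendsto_exp_stripBot.const_mul (f w₀))).mul h1
  rw [mul_zero, sub_zero, zero_mul] at h2
  refine h2.congr' ?_
  filter_upwards [tendsto_re_stripBot.eventually_lt_atBot w₀.re] with w hw
  rw [stripKernel_of_ne f (by rintro rfl; exact lt_irrefl _ hw)]
  ring

/-- By conjugation symmetry, the jump is -2i times the imaginary part on the upper edge. -/
lemma stripFun_lower_sub_upper {x : ℝ} (hx : x ≠ 0) :
    stripFun (x + (-Real.pi : ℝ) * I) - stripFun (x + Real.pi * I) =
      2 * Real.pi * I * rho (Real.exp x) := by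
  have h1 : (x + (-Real.pi : ℝ) * I : ℂ) = conj (x + Real.pi * I : ℂ) := by simp
  have h2 : (x + Real.pi * I : ℂ) ∈ strip := by simp [strip, abs_of_pos Real.pi_pos]
  rw [h1, stripFun_conj h2, ← neg_sub, sub_conj, stripFun_upper_im hx]
  push_cast
  ring

/-- Both edge points have exponential -e^x, so they share the kernel factor and the constant
`stripFun w₀` cancels. -/
lemma stripKernel_lower_sub_upper {w₀ : ℂ} (h₀ : |w₀.im| < Real.pi) {x : ℝ} (hx : x ≠ 0) :
    stripKernel stripFun w₀ (x + (-Real.pi : ℝ) * I) -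
        stripKernel stripFun w₀ (x + Real.pi * I) =
      2 * Real.pi * I *
        ((Real.exp x : ℂ) * ((rho (Real.exp x) : ℂ) / ((Real.exp x : ℝ) + exp w₀))) := by
  have h1 := (abs_lt.1 h₀)
  rw [stripKernel_of_ne, stripKernel_of_ne]
  · have he : exp (x + Real.pi * I) = -Real.exp x := by
      rw [exp_add, exp_pi_mul_I]; push_cast; ring
    have he' : exp (x + (-Real.pi : ℝ) * I) = -Real.exp x := by
      rw [exp_add]; push_cast; rw [neg_mul, exp_neg, exp_pi_mul_I]; norm_num
    have h2 := stripFun_lower_sub_upper hx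
    have h3 : -(Real.exp x : ℂ) / (-(Real.exp x : ℂ) - exp w₀) =
        Real.exp x / (Real.exp x + exp w₀) := by
      rw [← neg_div_neg_eq]; ring_nf
    rw [he, he', h3, ← sub_mul, sub_sub_sub_cancel_right, h2]
    ring
  · intro h
    have := congrArg im h
    simp at this
    linarith
  · intro h
    have := congrArg im h
    simp at this
    linarith

/-- The Stieltjes-type representation of `1 - G`. -/
theorem one_sub_complexG_eq_integral {z : ℂ} (hz : 0 < z.re) :
    1 - complexG z = ∫ t in Ioi (0 : ℝ), (rho t : ℂ) / (t + z) := by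
  have hp := Real.pi_pos
  have hz0 : z ≠ 0 := by rintro rfl; simp at hz
  set w₀ := log z with hw₀
  have he : exp w₀ = z := exp_log hz0
  have h₀ : |w₀.im| < Real.pi := by
    rw [hw₀, log_im]
    exact (abs_arg_lt_pi_div_two_iff.2 (Or.inl hz)).trans (by linarith)
  have hd : DifferentiableOn ℂ stripFun {w | |w.im| < Real.pi} := fun w hw =>
    (differentiableAt_stripFun hw).differentiableWithinAt
  have hK := continuousOn_stripKernel h₀ continuousOn_stripFun (differentiableAt_stripFun h₀)
  have hi := integrableOn_Ioi_iff_exp.1 (integrableOn_rho_div_add hz)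
  have hline : ∀ v : ℝ, |v| ≤ Real.pi → Continuous fun x : ℝ =>
      stripKernel stripFun w₀ (x + v * I) := fun v hv =>
    hK.comp_continuous (by fun_prop) fun x => by simpa [strip] using hv
  have hhor : ∀ R : ℝ, (∫ x in (-R)..R, stripKernel stripFun w₀ (x + (-Real.pi : ℝ) * I)) -
      (∫ x in (-R)..R, stripKernel stripFun w₀ (x + Real.pi * I)) =
      2 * Real.pi * I * ∫ x in (-R)..R,
        ((Real.exp x : ℂ) * ((rho (Real.exp x) : ℂ) / ((Real.exp x : ℝ) + z))) := by
    intro R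
    rw [← intervalIntegral.integral_sub
      ((hline (-Real.pi) (by simp [abs_of_pos hp])).intervalIntegrable _ _)
      ((hline Real.pi (by simp [abs_of_pos hp])).intervalIntegrable _ _),
      ← intervalIntegral.integral_const_mul]
    refine intervalIntegral.integral_congr_ae ?_
    -- The jump formula is available only off x = 0, that is t = 1, a null set.
    have h0 : ∀ᵐ x : ℝ, x ≠ 0 := by simp [ae_iff]
    filter_upwards [h0] with x hx _
    rw [stripKernel_lower_sub_upper h₀ hx, he]
  have hlim1 := (intervalIntegral_tendsto_integral hi tendsto_neg_atTop_atBot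
    tendsto_id).const_mul (2 * Real.pi * I)
  have hlim2 := (tendsto_integral_vertical hK
    (tendsto_stripKernel_stripTop tendsto_stripFun_stripTop)).const_mul I
  have hlim3 := ((tendsto_integral_vertical hK
    (tendsto_stripKernel_stripBot tendsto_stripFun_mul_exp_stripBot)).comp
      tendsto_neg_atTop_atBot).const_mul I
  have hlim := (hlim1.add hlim2).sub hlim3
  -- Cauchy's theorem makes the combination zero for every R, hence in the limit.
  have hzero := tendsto_nhds_unique hlim ((tendsto_const_nhds (x := (0 : ℂ))).congr fun R => by
    rw [← stripKernel_rectangle h₀ continuousOn_stripFun hd R, hhor R]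
    rfl)
  rw [← integral_Ioi_eq_integral_exp (fun t : ℝ => (rho t : ℂ) / (t + z)), hw₀,
    stripFun_log hz] at hzero
  have hpi : (2 * Real.pi * I : ℂ) ≠ 0 := by simp [hp.ne']
  refine mul_left_cancel₀ hpi ?_
  linear_combination -hzero

end AlzerQiGuo

namespace AlzerQiGuo

open Filter Topology

/-! ### Positivity of ∫ρ and of φ. -/

lemma complexG_ofReal {x : ℝ} (hx : 0 < x) : complexG x = realG x := by
  have h : (1 + x : ℂ) = ((1 + x : ℝ) : ℂ) := by push_cast; rfl
  rw [complexG, realG, h, ← Complex.ofReal_log hx.le, ← Complex.ofReal_log (by linarith)]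
  push_cast
  ring

lemma one_sub_realG_eq_integral {x : ℝ} (hx : 0 < x) :
    1 - realG x = ∫ t in Ioi (0 : ℝ), rho t / (t + x) := by
  have h := one_sub_complexG_eq_integral (z := x) (by simpa using hx)
  rw [complexG_ofReal hx] at h
  rw [← Complex.ofReal_inj, ← integral_complex_ofReal]
  push_cast
  exact h

lemma tendsto_mul_one_sub_realG :
    Tendsto (fun x : ℝ => x * (1 - realG x)) atTop (𝓝 (∫ t in Ioi (0 : ℝ), rho t)) := by
  have h : Tendsto (fun x : ℝ => ∫ t in Ioi (0 : ℝ), x * (rho t / (t + x))) atTop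
      (𝓝 (∫ t in Ioi (0 : ℝ), rho t)) := by
    refine tendsto_integral_filter_of_dominated_convergence (fun t => |rho t|) ?_ ?_
      integrableOn_rho.abs ?_
    · have := measurable_rho
      exact Eventually.of_forall fun x =>
        (by fun_prop : Measurable fun t => x * (rho t / (t + x))).aestronglyMeasurable
    · filter_upwards [eventually_gt_atTop 0] with x hx
      refine (ae_restrict_iff' measurableSet_Ioi).2 (Eventually.of_forall fun t ht => ?_)
      rw [mem_Ioi] at ht
      rw [Real.norm_eq_abs, abs_mul, abs_div, abs_of_pos hx, abs_of_pos (by linarith : 0 < t + x),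
        mul_div_assoc', div_le_iff₀ (by linarith)]
      nlinarith [abs_nonneg (rho t)]
    · refine Eventually.of_forall fun t => ?_
      have h1 : Tendsto (fun x : ℝ => (1 + t * x⁻¹)⁻¹) atTop (𝓝 1) := by
        have := (tendsto_inv_atTop_zero (𝕜 := ℝ)).const_mul t |>.const_add 1
        rw [mul_zero, add_zero] at this
        simpa using this.inv₀ one_ne_zero
      have h2 := h1.mul_const (rho t)
      rw [one_mul] at h2
      refine h2.congr' ?_
      filter_upwards [eventually_gt_atTop 0, eventually_gt_atTop (-t)] with x hx hxt
      have : 1 + t * x⁻¹ = (t + x) / x := by field_simp; ring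
      rw [this, inv_div]
      ring
  refine h.congr' ?_
  filter_upwards [eventually_gt_atTop 0] with x hx
  rw [integral_const_mul, one_sub_realG_eq_integral hx]

/-- With L = log x and d = log(1 + 1/x), the quantity is (L·x(1 - xd) + xd)/(L + d), so it suffices
that x(1 - xd) ≥ 1/4 and x ≥ 1. -/
lemma quarter_le_mul_one_sub_realG {x : ℝ} (hx : 1 ≤ x) : 1 / 4 ≤ x * (1 - realG x) := by
  have hL : 0 ≤ Real.log x := Real.log_nonneg hx
  have hlog : Real.log (1 + x) = Real.log x + Real.log ((1 + x) / x) := by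
    rw [Real.log_div (by linarith) (by linarith)]; ring
  have hs : 1 < (1 + x) / x := by rw [one_lt_div (by linarith)]; linarith
  have hd : 0 < Real.log ((1 + x) / x) := Real.log_pos hs
  -- This is d ≤ sinh d. The cruder d ≤ 1/x would give only x(1 - xd) ≥ 0.
  have hd' : Real.log ((1 + x) / x) * (2 * x * (x + 1)) ≤ 1 + 2 * x := by
    have h1 := Real.self_le_sinh_iff.2 hd.le
    rw [Real.sinh_log (by linarith)] at h1
    have h2 : ((1 + x) / x - ((1 + x) / x)⁻¹) / 2 = (1 + 2 * x) / (2 * x * (x + 1)) := by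
      field_simp
      ring
    rwa [h2, le_div_iff₀ (by positivity)] at h1
  rw [realG, hlog]
  set L := Real.log x
  set d := Real.log ((1 + x) / x)
  have hLd : L + d ≠ 0 := by positivity
  have h3 : x * (1 - (1 - L / (L + d)) * (x * L)) = (L * (x * (1 - x * d)) + x * d) / (L + d) := by
    field_simp
    ring
  rw [h3, le_div_iff₀ (by positivity)]
  have h4 : 1 / 4 ≤ x * (1 - x * d) := by
    by_contra hc
    push Not at hc
    nlinarith
  nlinarith [mul_le_mul_of_nonneg_left h4 hL, mul_le_mul_of_nonneg_right hx hd.le]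

lemma integral_rho_pos : 0 < ∫ t in Ioi (0 : ℝ), rho t :=
  lt_of_lt_of_le (by norm_num : (0 : ℝ) < 1 / 4) <|
    ge_of_tendsto tendsto_mul_one_sub_realG <|
      (eventually_ge_atTop 1).mono fun _ hx => quarter_le_mul_one_sub_realG hx

lemma rho_nonneg {t : ℝ} (h0 : 0 < t) (h : t ^ 2 ≤ 1 - t) : 0 ≤ rho t := by
  have h1 : t < 1 := by nlinarith
  have h2 : Real.log (1 - t) < 0 := Real.log_neg (by linarith) (by linarith)
  have h3 : 0 ≤ Real.log ((1 - t) / t ^ 2) :=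
    Real.log_nonneg ((one_le_div (by positivity)).2 h)
  rw [rho, if_pos h1, ← div_neg]
  have : 0 < -Real.log (1 - t) := by linarith
  positivity

lemma rho_nonpos {t : ℝ} (h0 : 0 < t) (h : 1 - t ≤ t ^ 2) : rho t ≤ 0 := by
  rcases lt_trichotomy t 1 with h1 | rfl | h1
  · have h2 : Real.log (1 - t) < 0 := Real.log_neg (by linarith) (by linarith)
    have h3 : Real.log ((1 - t) / t ^ 2) ≤ 0 :=
      Real.log_nonpos (div_nonneg (by linarith) (by positivity))
        ((div_le_one (by positivity)).2 h)
    rw [rho, if_pos h1, neg_nonpos]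
    exact div_nonneg_of_nonpos (mul_nonpos_of_nonneg_of_nonpos h0.le h3) h2.le
  · simp [rho]
  · have := Real.pi_pos
    rw [rho, if_neg h1.not_gt, if_pos h1, neg_nonpos]
    positivity

lemma integrableOn_exp_mul_rho {s : ℝ} (hs : 0 ≤ s) :
    IntegrableOn (fun t : ℝ => Real.exp (-(s * t)) * rho t) (Ioi 0) := by
  refine integrableOn_rho.bdd_mul (c := 1) ?_ ?_
  · exact (by fun_prop : Measurable fun t : ℝ => Real.exp (-(s * t))).aestronglyMeasurable
  · refine (ae_restrict_iff' measurableSet_Ioi).2 (Eventually.of_forall fun t ht => ?_)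
    rw [mem_Ioi] at ht
    rw [Real.norm_eq_abs, Real.abs_exp, Real.exp_le_one_iff]
    have := mul_nonneg hs ht.le
    linarith

lemma phi_pos {s : ℝ} (hs : 0 ≤ s) : 0 < phi s := by
  -- The sign change of ρ, where (1 - t)/t² = 1.
  obtain ⟨a, ha0, ha⟩ : ∃ a : ℝ, 0 < a ∧ a ^ 2 = 1 - a := by
    refine ⟨(Real.sqrt 5 - 1) / 2, ?_, ?_⟩
    · have : (1 : ℝ) < Real.sqrt 5 := Real.lt_sqrt_of_sq_lt (by norm_num)
      linarith
    · nlinarith [Real.sq_sqrt (show (0 : ℝ) ≤ 5 by norm_num)]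
  have h1 : Real.exp (-(s * a)) * ∫ t in Ioi (0 : ℝ), rho t ≤ phi s := by
    rw [phi, ← integral_const_mul]
    refine setIntegral_mono_on (integrableOn_rho.const_mul _) (integrableOn_exp_mul_rho hs)
      measurableSet_Ioi fun t ht => ?_
    rw [mem_Ioi] at ht
    rcases le_total t a with h | h
    · exact mul_le_mul_of_nonneg_right (Real.exp_le_exp.2 (by nlinarith))
        (rho_nonneg ht (by nlinarith))
    · exact mul_le_mul_of_nonpos_right (Real.exp_le_exp.2 (by nlinarith))
        (rho_nonpos ht (by nlinarith))
  exact (mul_pos (Real.exp_pos _) integral_rho_pos).trans_le h1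

/-! ### From the Stieltjes to the Laplace representation. -/

lemma integrable_prod_exp_mul_exp_mul_rho {z : ℂ} (hz : 0 < z.re) :
    Integrable (Function.uncurry fun s t : ℝ =>
      Complex.exp (-(z * s)) * ((Real.exp (-(s * t)) * rho t : ℝ) : ℂ))
      ((volume.restrict (Ioi 0)).prod (volume.restrict (Ioi 0))) := by
  have h1 : IntegrableOn (fun s : ℝ => Real.exp (-z.re * s)) (Ioi 0) := exp_neg_integrableOn_Ioi 0 hz
  have h2 : Integrable (fun t => |rho t|) (volume.restrict (Ioi 0)) := integrableOn_rho.abs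
  refine (Integrable.mul_prod h1 h2).mono' ?_ ?_
  · have := measurable_rho
    refine Measurable.aestronglyMeasurable ?_
    unfold Function.uncurry
    fun_prop
  · rw [Measure.prod_restrict]
    refine (ae_restrict_iff' (measurableSet_Ioi.prod measurableSet_Ioi)).2
      (Eventually.of_forall fun p hp => ?_)
    have hs : 0 < p.1 := hp.1
    have ht : 0 < p.2 := hp.2
    simp only [Function.uncurry]
    rw [norm_mul, Complex.norm_exp, Complex.norm_real, Real.norm_eq_abs, abs_mul, Real.abs_exp]
    have h3 : (-(z * p.1)).re = -z.re * p.1 := by simp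
    rw [h3]
    gcongr
    refine mul_le_of_le_one_left (abs_nonneg _) (Real.exp_le_one_iff.2 ?_)
    have := mul_pos hs ht
    linarith

lemma integral_exp_mul_exp_mul_rho (z : ℂ) (s : ℝ) :
    ∫ t in Ioi (0 : ℝ), Complex.exp (-(z * s)) * ((Real.exp (-(s * t)) * rho t : ℝ) : ℂ) =
      Complex.exp (-(z * s)) * (phi s : ℂ) := by
  rw [integral_const_mul, integral_complex_ofReal, phi]

lemma integrableOn_exp_mul_phi {z : ℂ} (hz : 0 < z.re) :
    IntegrableOn (fun s : ℝ => Complex.exp (-(z * s)) * (phi s : ℂ)) (Ioi 0) := by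
  have h := (integrable_prod_exp_mul_exp_mul_rho hz).integral_prod_left
  simp only [Function.uncurry, integral_exp_mul_exp_mul_rho] at h
  exact h

/-- `1 - G` is the Laplace transform of `φ`. -/
lemma one_sub_complexG_eq_laplace {z : ℂ} (hz : 0 < z.re) :
    1 - complexG z = ∫ s in Ioi (0 : ℝ), Complex.exp (-(z * s)) * (phi s : ℂ) := by
  have h := integral_integral_swap (integrable_prod_exp_mul_exp_mul_rho hz)
  simp only [integral_exp_mul_exp_mul_rho] at h
  rw [h, one_sub_complexG_eq_integral hz]
  refine setIntegral_congr_fun measurableSet_Ioi fun t ht => ?_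
  rw [mem_Ioi] at ht
  have h1 : ∀ s : ℝ, Complex.exp (-(z * s)) * ((Real.exp (-(s * t)) * rho t : ℝ) : ℂ) =
      Complex.exp (-(t + z) * s) * rho t := by
    intro s
    push_cast
    rw [← mul_assoc, ← Complex.exp_add]
    ring_nf
  simp only [h1]
  rw [integral_mul_const, integral_exp_mul_complex_Ioi (by simp; linarith),
    Complex.ofReal_zero, mul_zero, Complex.exp_zero, neg_div_neg_eq, one_div_mul_eq_div]

lemma integrableOn_exp_mul_phi_real {x : ℝ} (hx : 0 < x) :
    IntegrableOn (fun s : ℝ => phi s * Real.exp (x * -s)) (Ioi 0) := by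
  have h := (integrableOn_exp_mul_phi (z := x) (by simpa using hx)).re
  refine h.congr (Eventually.of_forall fun s => ?_)
  have : Complex.exp (-((x : ℂ) * s)) * (phi s : ℂ) = ((phi s * Real.exp (x * -s) : ℝ) : ℂ) := by
    push_cast; ring_nf
  simp only [this]
  exact Complex.ofReal_re _

lemma one_sub_realG_eq_laplace {x : ℝ} (hx : 0 < x) :
    1 - realG x = ∫ s in Ioi (0 : ℝ), phi s * Real.exp (x * -s) := by
  have h := one_sub_complexG_eq_laplace (z := x) (by simpa using hx)
  rw [complexG_ofReal hx] at h
  rw [← Complex.ofReal_inj, ← integral_complex_ofReal]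
  push_cast
  rw [h]
  congr 1 with s
  ring_nf

/-! ### Complete monotonicity through a moment generating function. -/

lemma measurable_phi : Measurable phi := by
  have h : StronglyMeasurable (Function.uncurry fun s t : ℝ => Real.exp (-(s * t)) * rho t) := by
    have := measurable_rho
    refine Measurable.stronglyMeasurable ?_
    unfold Function.uncurry
    fun_prop
  exact h.integral_prod_right.measurable

/-- The measure with density `φ` on the positive half-line. -/
noncomputable def phiMeasure : Measure ℝ :=
  (volume.restrict (Ioi 0)).withDensity fun s => ENNReal.ofReal (phi s)

lemma integral_phiMeasure (g : ℝ → ℝ) :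
    ∫ s, g s ∂phiMeasure = ∫ s in Ioi (0 : ℝ), phi s * g s := by
  rw [phiMeasure, integral_withDensity_eq_integral_toReal_smul
    measurable_phi.ennreal_ofReal (by simp)]
  refine setIntegral_congr_fun measurableSet_Ioi fun s hs => ?_
  simp only [ENNReal.toReal_ofReal (phi_pos (le_of_lt hs)).le, smul_eq_mul]

lemma integrable_phiMeasure_iff (g : ℝ → ℝ) :
    Integrable g phiMeasure ↔ IntegrableOn (fun s => phi s * g s) (Ioi 0) := by
  rw [phiMeasure, integrable_withDensity_iff_integrable_smul₀'
    measurable_phi.ennreal_ofReal.aemeasurable (by simp)]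
  refine integrable_congr ((ae_restrict_iff' measurableSet_Ioi).2
    (Eventually.of_forall fun s hs => ?_))
  simp only [ENNReal.toReal_ofReal (phi_pos (le_of_lt hs)).le, smul_eq_mul]

open ProbabilityTheory

lemma Ioi_subset_interior_integrableExpSet :
    Ioi 0 ⊆ interior (integrableExpSet (fun s : ℝ => -s) phiMeasure) := by
  refine interior_maximal (fun x hx => ?_) isOpen_Ioi
  exact (integrable_phiMeasure_iff _).2 (integrableOn_exp_mul_phi_real hx)

/-- This form brings in analyticity and differentiation under the integral from the theory of `mgf`;
the variable -s supplies the alternating signs. -/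
lemma one_sub_realG_eq_mgf {x : ℝ} (hx : 0 < x) :
    1 - realG x = mgf (fun s : ℝ => -s) phiMeasure x := by
  rw [one_sub_realG_eq_laplace hx, mgf, integral_phiMeasure]

lemma contDiffOn_one_sub_realG : ContDiffOn ℝ ∞ (fun x => 1 - realG x) (Ioi 0) :=
  ((analyticOn_mgf.mono Ioi_subset_interior_integrableExpSet).contDiffOn
    isOpen_Ioi.uniqueDiffOn).congr fun _ hx => one_sub_realG_eq_mgf hx

lemma iteratedDeriv_one_sub_realG_pos (n : ℕ) {x : ℝ} (hx : 0 < x) :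
    0 < (-1 : ℝ) ^ n * iteratedDeriv n (fun x => 1 - realG x) x := by
  have h1 : (fun x => 1 - realG x) =ᶠ[𝓝 x] mgf (fun s : ℝ => -s) phiMeasure :=
    by
    filter_upwards [Ioi_mem_nhds hx] with y hy using one_sub_realG_eq_mgf hy
  have hx' := Ioi_subset_interior_integrableExpSet hx
  have h2 := (integrable_phiMeasure_iff _).1
    ((integrable_pow_mul_exp_of_mem_interior_integrableExpSet hx' n).const_mul ((-1) ^ n))
  rw [h1.iteratedDeriv_eq, iteratedDeriv_mgf hx', ← integral_const_mul, integral_phiMeasure]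
  have h3 : ∀ s : ℝ, 0 < s →
      0 < phi s * ((-1) ^ n * ((-s) ^ n * Real.exp (x * -s))) := by
    intro s hs
    have := phi_pos hs.le
    rw [← mul_assoc ((-1 : ℝ) ^ n), ← mul_pow]
    simp only [neg_mul_neg, one_mul]
    positivity
  rw [setIntegral_pos_iff_support_of_nonneg_ae
    ((ae_restrict_iff' measurableSet_Ioi).2 (Eventually.of_forall fun s hs => (h3 s hs).le)) h2,
    inter_eq_self_of_subset_right (fun s (hs : s ∈ Ioi 0) =>
      Function.mem_support.2 (h3 s hs).ne')]
  simp

lemma iteratedDeriv_succ_one_sub_realG (n : ℕ) (x : ℝ) :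
    iteratedDeriv (n + 1) (fun x => 1 - realG x) x = -iteratedDeriv (n + 1) realG x := by
  have h : deriv (fun x => 1 - realG x) = fun x => -deriv realG x := by
    ext y; exact deriv_const_sub 1
  rw [iteratedDeriv_succ', h, iteratedDeriv_fun_neg, ← iteratedDeriv_succ']

lemma iteratedDeriv_succ_realG_pos (n : ℕ) {x : ℝ} (hx : 0 < x) :
    0 < (-1 : ℝ) ^ n * iteratedDeriv (n + 1) realG x := by
  have h := iteratedDeriv_one_sub_realG_pos (n + 1) hx
  rw [iteratedDeriv_succ_one_sub_realG, pow_succ] at h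
  linarith

lemma contDiffOn_deriv_realG : ContDiffOn ℝ ∞ (deriv realG) (Ioi 0) := by
  have h : ContDiffOn ℝ ∞ realG (Ioi 0) :=
    (contDiffOn_const (c := (1 : ℝ)).sub contDiffOn_one_sub_realG).congr fun x _ => by simp
  exact h.deriv_of_isOpen isOpen_Ioi (by simp)

end AlzerQiGuo

theorem theorem2 :
    -- the integral defining `φ(s)` converges and is strictly positive for all `s ≥ 0`
    (∀ s : ℝ, 0 ≤ s →
      IntegrableOn (fun t : ℝ => Real.exp (-(s * t)) * AlzerQiGuo.rho t) (Ioi 0) ∧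
        0 < AlzerQiGuo.phi s) ∧
    -- `1 - G` is the Laplace transform of `φ` in the right half-plane
    (∀ z : ℂ, 0 < z.re →
      IntegrableOn (fun s : ℝ => Complex.exp (-(z * s)) * (AlzerQiGuo.phi s : ℂ)) (Ioi 0) ∧
        1 - AlzerQiGuo.complexG z =
          ∫ s in Ioi (0 : ℝ), Complex.exp (-(z * s)) * (AlzerQiGuo.phi s : ℂ)) ∧
    -- complete monotonicity of `1 - G` and `G'` on `(0, ∞)`
    AlzerQiGuo.IsCompletelyMonotonic (fun x : ℝ => 1 - AlzerQiGuo.realG x) ∧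
    AlzerQiGuo.IsCompletelyMonotonic (deriv AlzerQiGuo.realG) ∧
    -- the strict inequalities conjectured by Qi and Guo
    (∀ k : ℕ, 1 ≤ k → ∀ x : ℝ, 0 < x →
      0 < (-1 : ℝ) ^ (k - 1) * iteratedDeriv k AlzerQiGuo.realG x) := by
  refine ⟨fun s hs => ⟨AlzerQiGuo.integrableOn_exp_mul_rho hs, AlzerQiGuo.phi_pos hs⟩,
    fun z hz => ⟨AlzerQiGuo.integrableOn_exp_mul_phi hz,
      AlzerQiGuo.one_sub_complexG_eq_laplace hz⟩,
    ⟨AlzerQiGuo.contDiffOn_one_sub_realG, fun n x hx =>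
      (AlzerQiGuo.iteratedDeriv_one_sub_realG_pos n hx).le⟩,
    ⟨AlzerQiGuo.contDiffOn_deriv_realG, fun n x hx => ?_⟩, fun k hk x hx => ?_⟩
  · rw [← iteratedDeriv_succ']
    exact (AlzerQiGuo.iteratedDeriv_succ_realG_pos n hx).le
  · obtain ⟨n, rfl⟩ := Nat.exists_eq_add_of_le' hk
    exact AlzerQiGuo.iteratedDeriv_succ_realG_pos n hx
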